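/- Let $\mathbb{S}^d$ be the space of real symmetric $d\times d$ matrices, and let $\mathrm{PSD}^d\subseteq\mathbb{S}^d$ be the positive semidefinite matrices, $\mathrm{NN}^d\subseteq\mathbb{S}^d$ the entrywise nonnegative symmetric matrices, $\mathrm{COP}^d=\{M\in\mathbb{S}^d : x^{\top}Mx\ge 0 \text{ for all } x\in\mathbb{R}^d_{+}\}$ the copositive matrices, and $\mathrm{CP}^d=\{B^{\top}B : B\in\mathbb{R}^{m\times d}_{+},\ m \in \mathbb{Z}_{\ge 0}\}$ the completely positive matrices. For $s=(i_1<\dots<i_k)$ in $\{1,\dots,d\}$ let $\mathrm{Lift}_s:\mathbb{S}^k\to\mathbb{S}^d$ put a $k\times k$ matrix at rows and columns $i_1,\dots,i_k$ and zeros elsewhere. For a sequence of cones $\mathcal{C}^m\subseteq\mathbb{S}^m$ ($m \ge 1$) and a set $J$ of increasing sequences of length $k$ in $\{1,\dots,d\}$, the $k$-th order cone induced by $\mathcal{C}^k$ with index set $J$ is $$\mathcal{C}^d_k(J)=\Bigl\{\sum_{s\in J}\mathrm{Lift}_s(M_s) : M_s\in\mathcal{C}^k\Bigr\},$$ and $\mathcal{C}^d_k$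 denotes this cone when $J$ consists of all increasing sequences of length $k$. A $k$-th order cone program ($k$OCP) over $K=\mathcal{C}^d_k(J)$ is a program in standard form, $$\text{minimize } \operatorname{tr}(A_0X)\quad\text{subject to } \operatorname{tr}(A_iX)=b_i\ (i=1,\dots,p),\ X\in K,$$ with $A_0,\dots,A_p\in\mathbb{R}^{d\times d}$ and $b\in\mathbb{R}^p$, or in inequality form, $$\text{minimize } q^{\top}x\quad\text{subject to } x_1P_1+\dots+x_nP_n+P_0\in K,\ x\in\mathbb{R}^n,$$ with $P_0,\dots,P_n\in\mathbb{S}^d$ and $q\in\mathbb{R}^n$. A program $P$ is cast into a program $Q$ by a linear map $\pi$ from the variable space of $Q$ to that of $P$ if $\pi$ maps the feasible set of $Q$ onto the feasible set of $P$ and the objective value of $Q$ at each feasible $y$ equals that of $P$ at $\pi(y)$. **Theorem.** (a) For $k=1,2,3,4$: $\mathrm{COP}^k=\mathrm{PSD}^k+\mathrm{NN}^k$ and $\mathrm{CP}^k=\mathrm{PSD}^k\cap\mathrm{NN}^k$. (b) Let $k\in\{2,3,4\}$, $d\ge k$, let $J$ be any set of increasing sequences of length $k$ in $\{1,\dots,d\}$,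 and let $\mathcal{C}$ be $\mathrm{COP}$ or $\mathrm{CP}$. Then every $k$OCP over $\mathcal{C}^d_k(J)$, in standard or in inequality form, can be cast into a $k$OCP over $\mathrm{PSD}^{d'}_k$ for some $d'\ge k$, of the same order $k$ and with the full index set; the latter can be taken in standard form and can also be taken in inequality form. In each of these four cases, $d'$, the number of linear constraints (respectively of variables) of the new program, and the linear map $\pi$ can be chosen to depend only on $\mathcal{C}$, $k$, $d$, $J$ and the number of linear constraints (respectively of variables) of the given program, not on its data $A_i,b$ (respectively $q,P_i$). -/

import Mathlib

open scoped Pointwise Matrix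

/-- The positive semidefinite real symmetric `d × d` matrices. -/
def psdCone (d : ℕ) : Set (Matrix (Fin d) (Fin d) ℝ) :=
  {A | A.PosSemidef}

/-- The entrywise nonnegative real symmetric `d × d` matrices. -/
def nnCone (d : ℕ) : Set (Matrix (Fin d) (Fin d) ℝ) :=
  {A | A.IsSymm ∧ ∀ i j, 0 ≤ A i j}

/-- The copositive `d × d` matrices: symmetric `M` with `xᵀ M x ≥ 0` for all `x ≥ 0`. -/
def copCone (d : ℕ) : Set (Matrix (Fin d) (Fin d) ℝ) :=
  {M | M.IsSymm ∧ ∀ x : Fin d → ℝ, (∀ i, 0 ≤ x i) → 0 ≤ x ⬝ᵥ (M *ᵥ x)}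

/-- The completely positive `d × d` matrices: `Bᵀ B` with `B` entrywise nonnegative. -/
def cpCone (d : ℕ) : Set (Matrix (Fin d) (Fin d) ℝ) :=
  {M | ∃ (m : ℕ) (B : Matrix (Fin m) (Fin d) ℝ), (∀ i j, 0 ≤ B i j) ∧ M = Bᵀ * B}

/-- The lift operator attached to an increasing sequence `s = (i_1 < ⋯ < i_k)` in `Fin d`:
the `k × k` matrix `X` is placed at the rows and columns `i_1, …, i_k` of a `d × d` matrix,
all other entries being zero. -/
def liftMatrix {k d : ℕ} (s : Fin k ↪o Fin d) (X : Matrix (Fin k) (Fin k) ℝ) :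
    Matrix (Fin d) (Fin d) ℝ :=
  Matrix.of fun a b => ∑ p, ∑ q, if s p = a ∧ s q = b then X p q else 0

theorem liftMatrix_apply_apply {k d : ℕ} (s : Fin k ↪o Fin d) (X : Matrix (Fin k) (Fin k) ℝ)
    (p q : Fin k) : liftMatrix s X (s p) (s q) = X p q := by
  simp [liftMatrix, ite_and]

theorem liftMatrix_apply_of_notMem {k d : ℕ} (s : Fin k ↪o Fin d)
    (X : Matrix (Fin k) (Fin k) ℝ) (a b : Fin d)
    (h : a ∉ Set.range s ∨ b ∉ Set.range s) : liftMatrix s X a b = 0 := by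
  have key : ∀ p q, ¬(s p = a ∧ s q = b) := by
    rintro p q ⟨rfl, rfl⟩
    simp at h
  simp [liftMatrix, key]

/-- The `k`-th order cone of `d × d` matrices with index set `J`, a set of increasing sequences
of length `k` in `Fin d`, induced by the sequence of cones `C 1, C 2, …`: the sums over `s ∈ J`
of lifts of elements of `C k`. -/
def orderCone (C : ∀ m : ℕ, Set (Matrix (Fin m) (Fin m) ℝ)) {k d : ℕ}
    (J : Finset (Fin k ↪o Fin d)) : Set (Matrix (Fin d) (Fin d) ℝ) :=
  {M | ∃ N : (Fin k ↪o Fin d) → Matrix (Fin k) (Fin k) ℝ,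
    (∀ s ∈ J, N s ∈ C k) ∧ M = ∑ s ∈ J, liftMatrix s (N s)}

/-- The problem of minimizing `objective` over `feasible`. -/
structure MinProblem (V : Type*) where
  feasible : Set V
  objective : V → ℝ

/-- The minimization problem `P` is cast into the minimization problem `Q` by the linear change
of variables `π`: the feasible points of `P` are exactly the images of those of `Q`, and the
objective value is preserved. -/
def MinProblem.CastVia {V W : Type*} [AddCommGroup V] [Module ℝ V] [AddCommGroup W] [Module ℝ W]
    (π : W →ₗ[ℝ] V) (P : MinProblem V) (Q : MinProblem W) : Prop :=
  π '' Q.feasible = P.feasible ∧ ∀ w ∈ Q.feasible, Q.objective w = P.objective (π w)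

/-- The data of a standard form program: minimize `tr (A₀ X)` subject to `tr (A i X) = b i` for
`p` indices `i` and `X` in a cone of symmetric `d × d` matrices. -/
structure StandardForm (d p : ℕ) where
  A₀ : Matrix (Fin d) (Fin d) ℝ
  A : Fin p → Matrix (Fin d) (Fin d) ℝ
  b : Fin p → ℝ

/-- The standard form program with the given data and the cone `K`. -/
def StandardForm.over {d p : ℕ} (P : StandardForm d p) (K : Set (Matrix (Fin d) (Fin d) ℝ)) :
    MinProblem (Matrix (Fin d) (Fin d) ℝ) where
  feasible := {X | (∀ i, (P.A i * X).trace = P.b i) ∧ X ∈ K}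
  objective X := (P.A₀ * X).trace

/-- The data of an inequality form program: minimize `qᵀ x` over `x ∈ ℝⁿ` subject to
`x 1 • P 1 + ⋯ + x n • P n + P₀` lying in a cone of symmetric `d × d` matrices. -/
structure InequalityForm (d n : ℕ) where
  q : Fin n → ℝ
  P₀ : Matrix (Fin d) (Fin d) ℝ
  P : Fin n → Matrix (Fin d) (Fin d) ℝ
  isSymm_P₀ : P₀.IsSymm
  isSymm_P : ∀ i, (P i).IsSymm

/-- The inequality form program with the given data and the cone `K`. -/
def InequalityForm.over {d n : ℕ} (P : InequalityForm d n)
    (K : Set (Matrix (Fin d) (Fin d) ℝ)) : MinProblem (Fin n → ℝ) where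
  feasible := {x | ∑ i, x i • P.P i + P.P₀ ∈ K}
  objective x := P.q ⬝ᵥ x

/-!
Completely positive matrices of order at most four. Let `A` be doubly nonnegative. Subtracting from
`A` the largest multiple `t • vecMulVec (A i) (A i)` of the outer square of a row, with
`t ≤ (A i i)⁻¹`, that keeps all entries nonnegative leaves a doubly nonnegative matrix
(`posSemidef_sub_smul_vecMulVec_row`), in which either row `i` has vanished or an off-diagonal entry
`(j, l)` has become zero (`IsDNNOn.exists_clear_row_or_zero`). The first case lowers the order. In
the second, for order three, a full Schur step at `j` does no harm, since each product
`A j a * A j b` it subtracts off the diagonal contains the zero `A j l`. For order four, the Schur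
complement of the rows `j` and `l` is a `2 × 2` matrix `R`, and a suitable convex splitting of `R`
writes `A` as a sum of two doubly nonnegative matrices of order three
(`IsDNNOn.mem_cpCone_of_zero`).

Copositive matrices of order at most four. If `M` is copositive and not in the closed convex cone
`psdCone k + nnCone k` (`isClosed_psdCone_add_nnCone`), it is separated from that cone by a trace
functional, whose symmetric part is doubly nonnegative, hence completely positive, hence nonnegative
on `M`.

Casting. By these two descriptions, each of the cones is a linear image of the set where finitely
many linear symmetric-matrix-valued maps are positive semidefinite (`IsBlockShadow`), and this
property passes to the induced order cones. Programs over such a cone are therefore cast into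
programs with `k × k` semidefinite blocks and linear equations (`blockProgram`) in which the blocks
do not depend on the data. A block diagonal matrix lies in the order cone of the semidefinite
matrices if and only if its blocks are semidefinite (`blockDiag_mem_orderCone_iff`), because that
cone consists of semidefinite matrices and contains all lifts. For the inequality form, an equation
is replaced by two opposite scalar inequalities; for the standard form, the blocks become the
diagonal blocks of the variable, and a free variable the difference of two diagonal entries.
-/

/-! ### Real positive semidefinite matrices -/

theorem posSemidef_iff_isSymm_and_nonneg {ι : Type*} [Fintype ι] {A : Matrix ι ι ℝ} :
    A.PosSemidef ↔ A.IsSymm ∧ ∀ x : ι → ℝ, 0 ≤ x ⬝ᵥ (A *ᵥ x) := by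
  rw [Matrix.posSemidef_iff_dotProduct_mulVec, Matrix.IsHermitian,
    Matrix.conjTranspose_eq_transpose_of_trivial, Matrix.IsSymm]
  simp

theorem Matrix.PosSemidef.isSymm_real {ι : Type*} [Fintype ι] {A : Matrix ι ι ℝ}
    (hA : A.PosSemidef) : A.IsSymm :=
  (posSemidef_iff_isSymm_and_nonneg.1 hA).1

theorem dotProduct_vecMulVec_mulVec {ι : Type*} [Fintype ι] (v x : ι → ℝ) :
    x ⬝ᵥ (Matrix.vecMulVec v v *ᵥ x) = (v ⬝ᵥ x) ^ 2 := by
  rw [Matrix.vecMulVec_mulVec, dotProduct_smul, dotProduct_comm x v]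
  simp [sq]

theorem isSymm_vecMulVec_self {ι : Type*} (v : ι → ℝ) : (Matrix.vecMulVec v v).IsSymm := by
  ext i j
  simp [Matrix.vecMulVec_apply, mul_comm]

theorem posSemidef_smul_vecMulVec {ι : Type*} [Fintype ι] (v : ι → ℝ) {t : ℝ} (ht : 0 ≤ t) :
    (t • Matrix.vecMulVec v v).PosSemidef := by
  refine posSemidef_iff_isSymm_and_nonneg.2 ⟨(isSymm_vecMulVec_self v).smul t, fun x => ?_⟩
  rw [Matrix.smul_mulVec, dotProduct_smul, dotProduct_vecMulVec_mulVec]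
  exact mul_nonneg ht (sq_nonneg _)

/-- Subtracting a multiple of the outer square of a row from a positive semidefinite matrix keeps
it positive semidefinite as long as the diagonal entry of that row does not become negative. -/
theorem posSemidef_sub_smul_vecMulVec_row {ι : Type*} [Fintype ι] [DecidableEq ι]
    {A : Matrix ι ι ℝ} (hA : A.PosSemidef) (i : ι) {t : ℝ} (ht : 0 ≤ t) (hti : t * A i i ≤ 1) :
    (A - t • Matrix.vecMulVec (A i) (A i)).PosSemidef := by
  obtain ⟨hs, hn⟩ := posSemidef_iff_isSymm_and_nonneg.1 hA
  refine posSemidef_iff_isSymm_and_nonneg.2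
    ⟨hs.sub ((isSymm_vecMulVec_self _).smul t), fun x => ?_⟩
  rw [Matrix.sub_mulVec, dotProduct_sub, Matrix.smul_mulVec, dotProduct_smul,
    dotProduct_vecMulVec_mulVec, smul_eq_mul]
  set c := A i ⬝ᵥ x with hc
  -- the quadratic form of `A` at `x - (t * c) • eᵢ` is nonnegative
  have h := hn (x - (t * c) • Pi.single i 1)
  have h1 : A *ᵥ Pi.single i 1 = A i := by
    rw [Matrix.mulVec_single_one]
    ext j
    exact hs.apply i j
  have h2 : (A *ᵥ x) i = c := rfl
  rw [Matrix.mulVec_sub, Matrix.mulVec_smul, h1, dotProduct_sub, sub_dotProduct, sub_dotProduct,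
    smul_dotProduct, smul_dotProduct, dotProduct_smul, dotProduct_smul, single_dotProduct,
    single_dotProduct, dotProduct_comm x (A i), ← hc, h2] at h
  simp only [smul_eq_mul, one_mul] at h
  have h3 : t * c ^ 2 * (t * A i i) ≤ t * c ^ 2 * 1 :=
    mul_le_mul_of_nonneg_left hti (mul_nonneg ht (sq_nonneg c))
  linarith

theorem row_eq_zero_of_diag_eq_zero {ι : Type*} [Fintype ι] [DecidableEq ι]
    {A : Matrix ι ι ℝ} (hA : A.PosSemidef) {i : ι} (hi : A i i = 0) (j : ι) : A i j = 0 := by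
  by_contra h
  have hpos : 0 < A i j ^ 2 := by positivity
  have hd := hA.diag_nonneg (i := j)
  have h1 := (posSemidef_sub_smul_vecMulVec_row hA i (t := (A j j + 1) / A i j ^ 2)
    (by positivity) (by simp [hi])).diag_nonneg (i := j)
  simp only [Matrix.sub_apply, Matrix.smul_apply, Matrix.vecMulVec_apply, smul_eq_mul, ← sq] at h1
  rw [div_mul_cancel₀ _ hpos.ne'] at h1
  linarith

theorem two_mul_abs_le_of_posSemidef {ι : Type*} [Fintype ι] [DecidableEq ι]
    {A : Matrix ι ι ℝ} (hA : A.PosSemidef) (i j : ι) : 2 * |A i j| ≤ A i i + A j j := by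
  obtain ⟨hs, hn⟩ := posSemidef_iff_isSymm_and_nonneg.1 hA
  have key : ∀ c : ℝ, 0 ≤ A i i + c * A i j + c * (A j i + c * A j j) := fun c => by
    have := hn (Pi.single i 1 + c • Pi.single j 1)
    simpa [Matrix.mulVec_add, Matrix.mulVec_smul, add_dotProduct, mul_add, add_assoc,
      add_left_comm] using this
  have h1 := key 1
  have h2 := key (-1)
  rw [hs.apply i j] at h1 h2
  rcases abs_cases (A i j) with h | h <;> linarith

/-! ### The cone of completely positive matrices -/

theorem zero_mem_cpCone (d : ℕ) : (0 : Matrix (Fin d) (Fin d) ℝ) ∈ cpCone d :=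
  ⟨0, 0, fun i => i.elim0, by simp⟩

theorem add_mem_cpCone {d : ℕ} {X Y : Matrix (Fin d) (Fin d) ℝ} (hX : X ∈ cpCone d)
    (hY : Y ∈ cpCone d) : X + Y ∈ cpCone d := by
  obtain ⟨m, B, hB, rfl⟩ := hX
  obtain ⟨n, D, hD, rfl⟩ := hY
  refine ⟨m + n, Matrix.of (Fin.append (fun i => B i) fun i => D i), fun i => ?_, ?_⟩
  · refine Fin.addCases (fun i j => ?_) (fun i j => ?_) i
    · simpa using hB i j
    · simpa using hD i j
  · ext a b
    simp [Matrix.mul_apply, Fin.sum_univ_add]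

theorem smul_vecMulVec_mem_cpCone {d : ℕ} {v : Fin d → ℝ} (hv : ∀ i, 0 ≤ v i) {t : ℝ}
    (ht : 0 ≤ t) : t • Matrix.vecMulVec v v ∈ cpCone d := by
  refine ⟨1, Matrix.of fun _ i => √t * v i,
    fun _ i => mul_nonneg (Real.sqrt_nonneg t) (hv i), ?_⟩
  ext a b
  simp only [Matrix.smul_apply, Matrix.vecMulVec_apply, smul_eq_mul, Matrix.mul_apply,
    Matrix.transpose_apply, Matrix.of_apply, Finset.univ_unique, Finset.sum_singleton]
  rw [mul_mul_mul_comm, Real.mul_self_sqrt ht]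

theorem cpCone_subset_psdCone_inter_nnCone (d : ℕ) : cpCone d ⊆ psdCone d ∩ nnCone d := by
  rintro _ ⟨m, B, hB, rfl⟩
  have h : (Bᵀ * B).PosSemidef := by
    rw [← Matrix.conjTranspose_eq_transpose_of_trivial]
    exact Matrix.posSemidef_conjTranspose_mul_self B
  refine ⟨h, h.isSymm_real, fun i j => ?_⟩
  rw [Matrix.mul_apply]
  exact Finset.sum_nonneg fun l _ => mul_nonneg (hB l i) (hB l j)

/-! ### Doubly nonnegative matrices of small support -/

/-- A doubly nonnegative matrix (positive semidefinite, with nonnegative entries) whose nonzero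
entries all lie in the rows and columns with index in `S`. -/
structure IsDNNOn {ι : Type*} (S : Finset ι) (A : Matrix ι ι ℝ) : Prop where
  posSemidef : A.PosSemidef
  nonneg : ∀ i j, 0 ≤ A i j
  row_eq_zero : ∀ i ∉ S, ∀ j, A i j = 0

namespace IsDNNOn

variable {ι : Type*} [Fintype ι] {S : Finset ι} {A : Matrix ι ι ℝ}

theorem symm (hA : IsDNNOn S A) (i j : ι) : A i j = A j i :=
  hA.posSemidef.isSymm_real.apply j i

theorem col_eq_zero (hA : IsDNNOn S A) (i : ι) {j : ι} (hj : j ∉ S) : A i j = 0 := by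
  rw [hA.symm, hA.row_eq_zero j hj]

variable [DecidableEq ι]

theorem sub_smul_vecMulVec (hA : IsDNNOn S A) (i : ι) {t : ℝ} (ht : 0 ≤ t)
    (hti : t * A i i ≤ 1)
    (h : ∀ j ∈ S.erase i, ∀ l ∈ S.erase i, j ≠ l → t * (A i j * A i l) ≤ A j l) :
    IsDNNOn S (A - t • Matrix.vecMulVec (A i) (A i)) := by
  have hpsd := posSemidef_sub_smul_vecMulVec_row hA.posSemidef i ht hti
  have hrow : ∀ l, 0 ≤ (A - t • Matrix.vecMulVec (A i) (A i)) i l := fun l => by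
    simp only [Matrix.sub_apply, Matrix.smul_apply, Matrix.vecMulVec_apply, smul_eq_mul]
    nlinarith [mul_nonneg (sub_nonneg.2 hti) (hA.nonneg i l)]
  refine ⟨hpsd, fun j l => ?_, fun j hj l => ?_⟩
  · by_cases hjS : j ∈ S
    · by_cases hlS : l ∈ S
      · rcases eq_or_ne j l with rfl | hjl
        · exact hpsd.diag_nonneg
        rcases eq_or_ne j i with rfl | hji
        · exact hrow l
        rcases eq_or_ne l i with rfl | hli
        · rw [← hpsd.isSymm_real.apply]
          exact hrow j
        · simpa [Matrix.vecMulVec_apply] using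
            h j (Finset.mem_erase.2 ⟨hji, hjS⟩) l (Finset.mem_erase.2 ⟨hli, hlS⟩) hjl
      · simp [Matrix.vecMulVec_apply, hA.col_eq_zero _ hlS]
    · simp [Matrix.vecMulVec_apply, hA.row_eq_zero _ hjS, hA.col_eq_zero _ hjS]
  · simp [Matrix.vecMulVec_apply, hA.row_eq_zero _ hj, hA.col_eq_zero _ hj]

/-- The full Schur step at `i` clears the row and column of `i`. -/
theorem schur_step (hA : IsDNNOn S A) (i : ι)
    (h : ∀ j ∈ S.erase i, ∀ l ∈ S.erase i, j ≠ l → (A i i)⁻¹ * (A i j * A i l) ≤ A j l) :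
    IsDNNOn (S.erase i) (A - (A i i)⁻¹ • Matrix.vecMulVec (A i) (A i)) := by
  have h0 := hA.sub_smul_vecMulVec i (inv_nonneg.2 (hA.nonneg i i)) inv_mul_le_one h
  refine ⟨h0.posSemidef, h0.nonneg, fun j hj l => ?_⟩
  by_cases hjS : j ∈ S
  · obtain rfl : j = i := by
      by_contra hji
      exact hj (Finset.mem_erase.2 ⟨hji, hjS⟩)
    simp only [Matrix.sub_apply, Matrix.smul_apply, Matrix.vecMulVec_apply, smul_eq_mul]
    by_cases hd : A j j = 0
    · simp [row_eq_zero_of_diag_eq_zero hA.posSemidef hd]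
    · field_simp
      ring
  · exact h0.row_eq_zero j hjS l

/-- Subtracting the largest admissible multiple of the outer square of row `i` either clears that
row or creates a zero off the diagonal. -/
theorem exists_clear_row_or_zero (hA : IsDNNOn S A) (i : ι) :
    ∃ t : ℝ, 0 ≤ t ∧ (IsDNNOn (S.erase i) (A - t • Matrix.vecMulVec (A i) (A i)) ∨
      (IsDNNOn S (A - t • Matrix.vecMulVec (A i) (A i)) ∧
        ∃ j ∈ S, ∃ l ∈ S, j ≠ l ∧ (A - t • Matrix.vecMulVec (A i) (A i)) j l = 0)) := by
  -- the off-diagonal positions that the full Schur step would make negative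
  set T := ((S.erase i) ×ˢ (S.erase i)).filter
    fun x => x.1 ≠ x.2 ∧ A x.1 x.2 < (A i i)⁻¹ * (A i x.1 * A i x.2) with hT
  have hinv : 0 ≤ (A i i)⁻¹ := inv_nonneg.2 (hA.nonneg i i)
  rcases T.eq_empty_or_nonempty with hemp | hne
  · refine ⟨(A i i)⁻¹, hinv, Or.inl (hA.schur_step i fun j hj l hl hjl => ?_)⟩
    by_contra hlt
    have hmem : (j, l) ∈ T := by
      rw [hT, Finset.mem_filter, Finset.mem_product]
      exact ⟨⟨hj, hl⟩, hjl, not_le.1 hlt⟩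
    simp [hemp] at hmem
  · obtain ⟨⟨j, l⟩, hmem, hmin⟩ :=
      T.exists_min_image (fun x => A x.1 x.2 / (A i x.1 * A i x.2)) hne
    have hposT : ∀ x ∈ T, 0 < A i x.1 * A i x.2 := fun x hx => by
      rw [hT, Finset.mem_filter] at hx
      refine lt_of_le_of_ne (mul_nonneg (hA.nonneg _ _) (hA.nonneg _ _)) fun h0 => ?_
      have := hx.2.2
      rw [← h0, mul_zero] at this
      exact absurd this (not_lt.2 (hA.nonneg _ _))
    have hpos := hposT _ hmem
    have hmem' := hmem
    rw [hT, Finset.mem_filter, Finset.mem_product] at hmem'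
    obtain ⟨⟨hj, hl⟩, hjl, hlt⟩ := hmem'
    dsimp only at hpos hmin hj hl hjl hlt
    have htinv : A j l / (A i j * A i l) ≤ (A i i)⁻¹ := by
      rw [div_le_iff₀ hpos]
      exact hlt.le
    have ht0 : 0 ≤ A j l / (A i j * A i l) := div_nonneg (hA.nonneg _ _) hpos.le
    refine ⟨_, ht0, Or.inr ⟨hA.sub_smul_vecMulVec i ht0 ?_ fun a ha b hb hab => ?_,
      j, Finset.mem_of_mem_erase hj, l, Finset.mem_of_mem_erase hl, hjl, ?_⟩⟩
    · exact (mul_le_mul_of_nonneg_right htinv (hA.nonneg i i)).trans inv_mul_le_one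
    · by_cases hab' : (a, b) ∈ T
      · exact (le_div_iff₀ (hposT _ hab')).1 (hmin _ hab')
      · rw [hT, Finset.mem_filter, Finset.mem_product] at hab'
        have : ¬ A a b < (A i i)⁻¹ * (A i a * A i b) := fun h => hab' ⟨⟨ha, hb⟩, hab, h⟩
        exact (mul_le_mul_of_nonneg_right htinv
          (mul_nonneg (hA.nonneg _ _) (hA.nonneg _ _))).trans (not_lt.1 this)
    · simp only [Matrix.sub_apply, Matrix.smul_apply, Matrix.vecMulVec_apply, smul_eq_mul]
      rw [div_mul_cancel₀ _ hpos.ne', sub_self]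

end IsDNNOn

theorem mem_cpCone_of_sub_mem {d : ℕ} {A : Matrix (Fin d) (Fin d) ℝ} {S : Finset (Fin d)}
    (hA : IsDNNOn S A) (i : Fin d) {t : ℝ} (ht : 0 ≤ t)
    (h : A - t • Matrix.vecMulVec (A i) (A i) ∈ cpCone d) : A ∈ cpCone d := by
  have := add_mem_cpCone h (smul_vecMulVec_mem_cpCone (hA.nonneg i) ht)
  rwa [sub_add_cancel] at this

/-- On at most two indices, full Schur steps preserve nonnegativity, as they alter only diagonal
entries outside the cleared row and column. -/
theorem IsDNNOn.mem_cpCone_of_card_le_two {d : ℕ} {S : Finset (Fin d)} (hS : S.card ≤ 2)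
    {A : Matrix (Fin d) (Fin d) ℝ} (hA : IsDNNOn S A) : A ∈ cpCone d := by
  induction hn : S.card generalizing S A with
  | zero =>
    rw [Finset.card_eq_zero] at hn
    obtain rfl : A = 0 := by
      ext i j
      exact hA.row_eq_zero i (by simp [hn]) j
    exact zero_mem_cpCone d
  | succ n ih =>
    obtain ⟨i, hi⟩ := Finset.card_pos.1 (by omega : 0 < S.card)
    have hc := Finset.card_erase_of_mem hi
    refine mem_cpCone_of_sub_mem hA i (inv_nonneg.2 (hA.nonneg i i))
      (ih (S := S.erase i) (by omega) (hA.schur_step i fun j hj l hl hjl => ?_) (by omega))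
    -- there is no pair of distinct indices besides `i`
    exact absurd (Finset.card_le_one.1 (by omega) j hj l hl) hjl

theorem IsDNNOn.mem_cpCone_of_card_le_three {d : ℕ} {S : Finset (Fin d)} (hS : S.card ≤ 3)
    {A : Matrix (Fin d) (Fin d) ℝ} (hA : IsDNNOn S A) : A ∈ cpCone d := by
  rcases S.eq_empty_or_nonempty with rfl | ⟨i, hi⟩
  · exact hA.mem_cpCone_of_card_le_two (by simp)
  obtain ⟨t, ht, h | ⟨h, j, hj, l, hl, hjl, hz⟩⟩ := hA.exists_clear_row_or_zero i
  · refine mem_cpCone_of_sub_mem hA i ht (h.mem_cpCone_of_card_le_two ?_)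
    have hc := Finset.card_erase_of_mem hi
    omega
  · refine mem_cpCone_of_sub_mem hA i ht ?_
    set B := A - t • Matrix.vecMulVec (A i) (A i)
    have hc := Finset.card_erase_of_mem hj
    refine mem_cpCone_of_sub_mem h j (inv_nonneg.2 (h.nonneg j j))
      (IsDNNOn.mem_cpCone_of_card_le_two (S := S.erase j) (by omega)
        (h.schur_step j fun a ha b hb hab => ?_))
    -- one of the two indices besides `j` is `l`, where the row of `j` vanishes
    have hl' : l ∈ S.erase j := Finset.mem_erase.2 ⟨hjl.symm, hl⟩
    have hab' : a = l ∨ b = l := by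
      by_contra! hne
      have hsub : ({a, b, l} : Finset (Fin d)) ⊆ S.erase j := by
        simp [Finset.insert_subset_iff, -Finset.mem_erase, ha, hb, hl']
      have h3 : ({a, b, l} : Finset (Fin d)).card = 3 :=
        Finset.card_eq_three.2 ⟨a, b, l, hab, hne.1, hne.2, rfl⟩
      have := Finset.card_le_card hsub
      omega
    have h0 : B j a * B j b = 0 := by
      rcases hab' with rfl | rfl <;> simp [hz]
    rw [h0, mul_zero]
    exact h.nonneg a b

theorem exists_convex_split {p q r : ℝ} (hp : 0 ≤ p) (hq : 0 ≤ q) (h : 0 ≤ p + q + r) :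
    ∃ t, 0 ≤ t ∧ t ≤ 1 ∧ 0 ≤ p + t * r ∧ 0 ≤ q + (1 - t) * r := by
  rcases le_or_gt 0 r with hr | hr
  · exact ⟨0, le_rfl, zero_le_one, by simpa, by simpa using add_nonneg hq hr⟩
  rcases le_or_gt 0 (p + r) with hpr | hpr
  · exact ⟨1, zero_le_one, le_rfl, by simpa, by simpa⟩
  · refine ⟨p / -r, div_nonneg hp (by linarith), ?_, ?_, ?_⟩
    · rw [div_le_one (by linarith)]
      linarith
    all_goals
      have : p / -r * r = -p := by
        rw [div_neg, neg_mul, div_mul_cancel₀ _ hr.ne]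
      linarith

/-- A doubly nonnegative matrix on four indices with a zero at an off-diagonal position `(j, l)`
is the sum of two doubly nonnegative matrices, one avoiding `l` and one avoiding `j`. After two
Schur steps at `j` and `l` only a `2 × 2` block `R` remains; if its off-diagonal entry is negative,
it is shared between the two outer squares. -/
theorem IsDNNOn.mem_cpCone_of_zero {d : ℕ} {S : Finset (Fin d)} (hS : S.card ≤ 4)
    {A : Matrix (Fin d) (Fin d) ℝ} (hA : IsDNNOn S A) {j l : Fin d} (hj : j ∈ S) (hl : l ∈ S)
    (hjl : j ≠ l) (hz : A j l = 0) : A ∈ cpCone d := by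
  set V := (A j j)⁻¹ • Matrix.vecMulVec (A j) (A j) with hV
  set W := (A l l)⁻¹ • Matrix.vecMulVec (A l) (A l) with hW
  have hVn : ∀ a b, 0 ≤ V a b := fun a b =>
    mul_nonneg (inv_nonneg.2 (hA.nonneg j j)) (mul_nonneg (hA.nonneg j a) (hA.nonneg j b))
  have hWn : ∀ a b, 0 ≤ W a b := fun a b =>
    mul_nonneg (inv_nonneg.2 (hA.nonneg l l)) (mul_nonneg (hA.nonneg l a) (hA.nonneg l b))
  have hVp : V.PosSemidef := posSemidef_smul_vecMulVec _ (inv_nonneg.2 (hA.nonneg j j))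
  have hWp : W.PosSemidef := posSemidef_smul_vecMulVec _ (inv_nonneg.2 (hA.nonneg l l))
  set R := A - V - W with hR
  have hz' : A l j = 0 := by rw [hA.symm, hz]
  have hVrow : ∀ b, V j b = A j b := fun b => by
    simp only [hV, Matrix.smul_apply, Matrix.vecMulVec_apply, smul_eq_mul]
    by_cases hd : A j j = 0
    · simp [row_eq_zero_of_diag_eq_zero hA.posSemidef hd]
    · field_simp
  have hWrow : ∀ b, W l b = A l b := fun b => by
    simp only [hW, Matrix.smul_apply, Matrix.vecMulVec_apply, smul_eq_mul]
    by_cases hd : A l l = 0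
    · simp [row_eq_zero_of_diag_eq_zero hA.posSemidef hd]
    · field_simp
  have hVl : ∀ b, V l b = 0 := fun b => by simp [hV, Matrix.vecMulVec_apply, hz]
  have hWj : ∀ b, W j b = 0 := fun b => by simp [hW, Matrix.vecMulVec_apply, hz']
  have hVS : ∀ a ∉ S, ∀ b, V a b = 0 := fun a ha b => by
    simp [hV, Matrix.vecMulVec_apply, hA.col_eq_zero _ ha]
  have hWS : ∀ a ∉ S, ∀ b, W a b = 0 := fun a ha b => by
    simp [hW, Matrix.vecMulVec_apply, hA.col_eq_zero _ ha]
  have hRp : R.PosSemidef := by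
    have h1 := posSemidef_sub_smul_vecMulVec_row hA.posSemidef j (inv_nonneg.2 (hA.nonneg j j))
      inv_mul_le_one
    have hrow : (A - V) l = A l := by
      ext b
      simp [hVl]
    have h2 := posSemidef_sub_smul_vecMulVec_row h1 l (t := (A l l)⁻¹)
      (inv_nonneg.2 (hA.nonneg l l)) (by
        rw [← hV, hrow]
        exact inv_mul_le_one)
    rw [← hV, hrow] at h2
    exact h2
  have hRrow : ∀ a, a ∉ (S.erase j).erase l → ∀ b, R a b = 0 := fun a ha b => by
    rcases eq_or_ne a l with rfl | hal
    · simp [hR, hVl, hWrow]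
    rcases eq_or_ne a j with rfl | haj
    · simp [hR, hWj, hVrow]
    have haS : a ∉ S := fun h => ha (by simp [hal, haj, h])
    simp [hR, hVS a haS, hWS a haS, hA.row_eq_zero a haS]
  have hRsym := hRp.isSymm_real
  -- it suffices to share out `R` in such a way that both parts have nonnegative entries
  suffices h : ∃ t, 0 ≤ t ∧ t ≤ 1 ∧
      ∀ a ∈ (S.erase j).erase l, ∀ b ∈ (S.erase j).erase l, a ≠ b →
        0 ≤ V a b + t * R a b ∧ 0 ≤ W a b + (1 - t) * R a b by
    obtain ⟨t, ht0, ht1, ht⟩ := h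
    have hn : ∀ a b, 0 ≤ V a b + t * R a b ∧ 0 ≤ W a b + (1 - t) * R a b := fun a b => by
      by_cases ha : a ∈ (S.erase j).erase l
      · by_cases hb : b ∈ (S.erase j).erase l
        · rcases eq_or_ne a b with rfl | hab
          · have := hRp.diag_nonneg (i := a)
            exact ⟨add_nonneg (hVn _ _) (mul_nonneg ht0 this),
              add_nonneg (hWn _ _) (mul_nonneg (sub_nonneg.2 ht1) this)⟩
          · exact ht a ha b hb hab
        · simp [← hRsym.apply a b, hRrow b hb, hVn, hWn]
      · simp [hRrow a ha, hVn, hWn]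
    have h1 : IsDNNOn (S.erase l) (V + t • R) := by
      refine ⟨hVp.add (hRp.smul ht0), fun a b => (hn a b).1, fun a ha b => ?_⟩
      have hR0 : R a b = 0 := hRrow a (fun h => ha (by
        simp only [Finset.mem_erase] at h ⊢
        exact ⟨h.1, h.2.2⟩)) b
      have hV0 : V a b = 0 := by
        rcases eq_or_ne a l with rfl | hal
        · exact hVl b
        · exact hVS a (fun h => ha (Finset.mem_erase.2 ⟨hal, h⟩)) b
      simp [hR0, hV0]
    have h2 : IsDNNOn (S.erase j) (W + (1 - t) • R) := by
      refine ⟨hWp.add (hRp.smul (sub_nonneg.2 ht1)), fun a b => (hn a b).2, fun a ha b => ?_⟩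
      have hR0 : R a b = 0 := hRrow a (fun h => ha (Finset.mem_of_mem_erase h)) b
      have hW0 : W a b = 0 := by
        rcases eq_or_ne a j with rfl | haj
        · exact hWj b
        · exact hWS a (fun h => ha (Finset.mem_erase.2 ⟨haj, h⟩)) b
      simp [hR0, hW0]
    have hc1 := Finset.card_erase_of_mem hj
    have hc2 := Finset.card_erase_of_mem hl
    have hsum := add_mem_cpCone (h1.mem_cpCone_of_card_le_three (by omega))
      (h2.mem_cpCone_of_card_le_three (by omega))
    have hAeq : A = V + t • R + (W + (1 - t) • R) := by
      rw [sub_smul, one_smul, hR]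
      abel
    rw [hAeq]
    exact hsum
  have hcard : ((S.erase j).erase l).card ≤ 2 := by
    rw [Finset.card_erase_of_mem (Finset.mem_erase.2 ⟨hjl.symm, hl⟩), Finset.card_erase_of_mem hj]
    omega
  by_cases hone : ((S.erase j).erase l).card ≤ 1
  · exact ⟨0, le_rfl, zero_le_one, fun a ha b hb hab =>
      absurd (Finset.card_le_one.1 hone a ha b hb) hab⟩
  obtain ⟨x, y, hxy, hT⟩ := Finset.card_eq_two.1 (by omega : ((S.erase j).erase l).card = 2)
  obtain ⟨t, ht0, ht1, h1, h2⟩ := exists_convex_split (hVn x y) (hWn x y) (r := R x y) (by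
    have := hA.nonneg x y
    simp only [hR, Matrix.sub_apply]
    linarith)
  refine ⟨t, ht0, ht1, fun a ha b hb hab => ?_⟩
  rw [hT] at ha hb
  simp only [Finset.mem_insert, Finset.mem_singleton] at ha hb
  rcases ha with rfl | rfl <;> rcases hb with rfl | rfl
  · exact absurd rfl hab
  · exact ⟨h1, h2⟩
  · rw [← hRsym.apply, ← hVp.isSymm_real.apply, ← hWp.isSymm_real.apply]
    exact ⟨h1, h2⟩
  · exact absurd rfl hab

theorem IsDNNOn.mem_cpCone_of_card_le_four {d : ℕ} {S : Finset (Fin d)} (hS : S.card ≤ 4)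
    {A : Matrix (Fin d) (Fin d) ℝ} (hA : IsDNNOn S A) : A ∈ cpCone d := by
  rcases S.eq_empty_or_nonempty with rfl | ⟨i, hi⟩
  · exact hA.mem_cpCone_of_card_le_two (by simp)
  obtain ⟨t, ht, h | ⟨h, j, hj, l, hl, hjl, hz⟩⟩ := hA.exists_clear_row_or_zero i
  · refine mem_cpCone_of_sub_mem hA i ht (h.mem_cpCone_of_card_le_three ?_)
    have hc := Finset.card_erase_of_mem hi
    omega
  · exact mem_cpCone_of_sub_mem hA i ht (h.mem_cpCone_of_zero hS hj hl hjl hz)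

theorem cpCone_eq_psdCone_inter_nnCone {k : ℕ} (hk : k ≤ 4) :
    cpCone k = psdCone k ∩ nnCone k := by
  refine (cpCone_subset_psdCone_inter_nnCone k).antisymm fun A hA => ?_
  refine IsDNNOn.mem_cpCone_of_card_le_four (S := Finset.univ) (by simpa using hk)
    ⟨hA.1, hA.2.2, fun i hi => absurd (Finset.mem_univ i) hi⟩

/-! ### Copositive matrices by duality -/

/-- Every linear functional on matrices is a trace functional. -/
theorem exists_eq_trace_mul {d : ℕ} (f : Matrix (Fin d) (Fin d) ℝ →ₗ[ℝ] ℝ) :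
    ∃ A : Matrix (Fin d) (Fin d) ℝ, ∀ X, f X = (A * X).trace := by
  refine ⟨Matrix.of fun j i => f (Matrix.single i j 1), fun X => ?_⟩
  conv_lhs => rw [Matrix.matrix_eq_sum_single X]
  simp only [map_sum, Matrix.trace, Matrix.diag_apply, Matrix.mul_apply, Matrix.of_apply]
  rw [Finset.sum_comm]
  refine Finset.sum_congr rfl fun j _ => Finset.sum_congr rfl fun i _ => ?_
  rw [← mul_one (X i j), ← smul_eq_mul, ← Matrix.smul_single, map_smul, smul_eq_mul, mul_comm]
  simp

theorem isClosed_psdCone (d : ℕ) : IsClosed (psdCone d) := by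
  have : psdCone d = {A | Aᵀ = A} ∩ ⋂ x : Fin d → ℝ, {A | 0 ≤ x ⬝ᵥ (A *ᵥ x)} := by
    ext A
    simp [psdCone, posSemidef_iff_isSymm_and_nonneg, Matrix.IsSymm]
  rw [this]
  refine (isClosed_eq (by fun_prop) (by fun_prop)).inter (isClosed_iInter fun x => ?_)
  exact isClosed_le (by fun_prop) (by fun_prop)

theorem isClosed_nnCone (d : ℕ) : IsClosed (nnCone d) := by
  have : nnCone d = {A | Aᵀ = A} ∩ ⋂ i, ⋂ j, {A | 0 ≤ A i j} := by
    ext A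
    simp [nnCone, Matrix.IsSymm]
  rw [this]
  refine (isClosed_eq (by fun_prop) (by fun_prop)).inter
    (isClosed_iInter fun i => isClosed_iInter fun j => ?_)
  exact isClosed_le (by fun_prop) (by fun_prop)

theorem isCompact_psdCone_inter_diag_le (d : ℕ) (c : ℝ) :
    IsCompact {A | A ∈ psdCone d ∧ ∀ i, A i i ≤ c} := by
  have hbox : IsCompact (Set.univ.pi fun _ => Set.univ.pi fun _ => Set.Icc (-c) c :
      Set (Fin d → Fin d → ℝ)) :=
    isCompact_univ_pi fun _ => isCompact_univ_pi fun _ => isCompact_Icc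
  refine IsCompact.of_isClosed_subset (X := Matrix (Fin d) (Fin d) ℝ) hbox ?_ ?_
  · have : {A : Matrix (Fin d) (Fin d) ℝ | A ∈ psdCone d ∧ ∀ i, A i i ≤ c} =
        psdCone d ∩ ⋂ i, {A | A i i ≤ c} := by
      ext A
      simp
    rw [this]
    exact (isClosed_psdCone d).inter
      (isClosed_iInter fun i => isClosed_le (by fun_prop) (by fun_prop))
  · rintro A ⟨hA, hc⟩ i - j -
    have := two_mul_abs_le_of_posSemidef hA i j
    exact abs_le.1 (by linarith [hc i, hc j])

/-- The sum of the two closed cones is closed: near a limit point the diagonal of the semidefinite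
summand is bounded by that of the sum, so the semidefinite summands range over a compact set. -/
theorem isClosed_psdCone_add_nnCone (d : ℕ) : IsClosed (psdCone d + nnCone d) := by
  refine isClosed_of_closure_subset fun M hM => ?_
  set c := (∑ i, |M i i|) + 1 with hc
  have hopen : IsOpen {A : Matrix (Fin d) (Fin d) ℝ | ∀ i, A i i < c} := by
    simp only [Set.ofPred_forall]
    exact isOpen_iInter_of_finite fun i => isOpen_lt (by fun_prop) (by fun_prop)
  have hMc : M ∈ {A : Matrix (Fin d) (Fin d) ℝ | ∀ i, A i i < c} := fun i => by
    have := Finset.single_le_sum (f := fun i => |M i i|) (fun _ _ => abs_nonneg _)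
      (Finset.mem_univ i)
    have := le_abs_self (M i i)
    simp only [hc]
    linarith
  have hcl : IsClosed ({A | A ∈ psdCone d ∧ ∀ i, A i i ≤ c} + nnCone d) :=
    (isClosed_nnCone d).add_left_of_isCompact (isCompact_psdCone_inter_diag_le d c)
  have hsub : (psdCone d + nnCone d) ∩ {A : Matrix (Fin d) (Fin d) ℝ | ∀ i, A i i < c} ⊆
      {A | A ∈ psdCone d ∧ ∀ i, A i i ≤ c} + nnCone d := by
    rintro _ ⟨⟨P, hP, N, hN, rfl⟩, hlt⟩
    refine ⟨P, ⟨hP, fun i => ?_⟩, N, hN, rfl⟩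
    have h1 := hlt i
    have h2 := hN.2 i i
    simp only [Matrix.add_apply] at h1
    linarith
  rw [Set.inter_comm] at hsub
  have hM' := closure_mono hsub (hopen.inter_closure ⟨hMc, hM⟩)
  rw [hcl.closure_eq] at hM'
  obtain ⟨P, hP, N, hN, h⟩ := hM'
  exact ⟨P, hP.1, N, hN, h⟩

theorem convex_psdCone_add_nnCone (d : ℕ) : Convex ℝ (psdCone d + nnCone d) := by
  refine Convex.add (fun A hA B hB a b ha hb _ => (hA.smul ha).add (hB.smul hb)) ?_
  refine fun A hA B hB a b ha hb _ => ⟨(hA.1.smul a).add (hB.1.smul b), fun i j => ?_⟩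
  exact add_nonneg (mul_nonneg ha (hA.2 i j)) (mul_nonneg hb (hB.2 i j))

theorem psdCone_add_nnCone_subset_copCone (d : ℕ) : psdCone d + nnCone d ⊆ copCone d := by
  rintro _ ⟨P, hP, N, hN, rfl⟩
  refine ⟨hP.isSymm_real.add hN.1, fun x hx => ?_⟩
  rw [Matrix.add_mulVec, dotProduct_add]
  refine add_nonneg ((posSemidef_iff_isSymm_and_nonneg.1 hP).2 x) ?_
  exact dotProduct_nonneg_of_nonneg hx fun i => dotProduct_nonneg_of_nonneg (hN.2 i) hx

theorem trace_mul_nonneg_of_mem_cpCone {d : ℕ} {D M : Matrix (Fin d) (Fin d) ℝ}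
    (hD : D ∈ cpCone d) (hM : M ∈ copCone d) : 0 ≤ (D * M).trace := by
  obtain ⟨m, B, hB, rfl⟩ := hD
  rw [Matrix.mul_assoc, Matrix.trace_mul_comm, Matrix.trace]
  refine Finset.sum_nonneg fun r _ => ?_
  have h := hM.2 (B r) (hB r)
  have : (B * M * Bᵀ).diag r = B r ⬝ᵥ (M *ᵥ B r) := by
    rw [Matrix.dotProduct_mulVec]
    rfl
  rwa [this]

theorem copCone_eq_psdCone_add_nnCone {k : ℕ} (hk : k ≤ 4) :
    copCone k = psdCone k + nnCone k := by
  refine Set.Subset.antisymm (fun M hM => ?_) (psdCone_add_nnCone_subset_copCone k)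
  by_contra hnot
  have : LocallyConvexSpace ℝ (Matrix (Fin k) (Fin k) ℝ) :=
    inferInstanceAs (LocallyConvexSpace ℝ (Fin k → Fin k → ℝ))
  obtain ⟨f, u, hfM, hfK⟩ := geometric_hahn_banach_point_closed (convex_psdCone_add_nnCone k)
    (isClosed_psdCone_add_nnCone k) hnot
  have h0p : (0 : Matrix (Fin k) (Fin k) ℝ) ∈ psdCone k := Matrix.PosSemidef.zero
  have h0n : (0 : Matrix (Fin k) (Fin k) ℝ) ∈ nnCone k := ⟨Matrix.isSymm_zero, fun _ _ => le_rfl⟩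
  have hu : u < 0 := by simpa using hfK 0 ⟨0, h0p, 0, h0n, add_zero 0⟩
  -- bounded below on a cone, `f` is nonnegative there
  have hf : ∀ X, (∀ t : ℝ, 0 ≤ t → t • X ∈ psdCone k + nnCone k) → 0 ≤ f X := fun X hX => by
    by_contra! hneg
    have h1 := hfK _ (hX (u / f X) (div_nonneg_of_nonpos hu.le hneg.le))
    rw [map_smul, smul_eq_mul, div_mul_cancel₀ _ hneg.ne] at h1
    exact lt_irrefl _ h1
  obtain ⟨A, hA⟩ := exists_eq_trace_mul (f : Matrix (Fin k) (Fin k) ℝ →ₗ[ℝ] ℝ)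
  have hA : ∀ X, f X = (A * X).trace := hA
  set D := A + Aᵀ with hD
  have hDX : ∀ X : Matrix (Fin k) (Fin k) ℝ, X.IsSymm → (D * X).trace = 2 * f X := fun X hX => by
    rw [hD, Matrix.add_mul, Matrix.trace_add, hA, two_mul]
    congr 1
    rw [← Matrix.trace_transpose, Matrix.transpose_mul, Matrix.transpose_transpose, hX.eq,
      Matrix.trace_mul_comm]
  have hDs : D.IsSymm := by
    rw [Matrix.IsSymm, hD, Matrix.transpose_add, Matrix.transpose_transpose, add_comm]
  have hDp : D.PosSemidef := by
    refine posSemidef_iff_isSymm_and_nonneg.2 ⟨hDs, fun x => ?_⟩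
    have h1 := hf (Matrix.vecMulVec x x) fun t ht =>
      ⟨_, posSemidef_smul_vecMulVec x ht, 0, h0n, add_zero _⟩
    have h2 : (D * Matrix.vecMulVec x x).trace = x ⬝ᵥ (D *ᵥ x) := by
      rw [Matrix.mul_vecMulVec, Matrix.trace_vecMulVec, dotProduct_comm]
    rw [← h2, hDX _ (isSymm_vecMulVec_self x)]
    linarith
  have hDn : ∀ i j, 0 ≤ D i j := fun i j => by
    set E : Matrix (Fin k) (Fin k) ℝ := Matrix.single i j 1 + Matrix.single j i 1 with hE
    have hEs : E.IsSymm := by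
      rw [Matrix.IsSymm, hE, Matrix.transpose_add, Matrix.transpose_single,
        Matrix.transpose_single, add_comm]
    have hEn : ∀ a b, 0 ≤ E a b := fun a b => by
      simp only [hE, Matrix.add_apply, Matrix.single_apply]
      split_ifs <;> norm_num
    have h1 := hf E fun t ht =>
      ⟨0, h0p, t • E, ⟨hEs.smul t, fun a b => mul_nonneg ht (hEn a b)⟩, zero_add _⟩
    have h2 : (D * E).trace = 2 * D i j := by
      rw [hE, Matrix.mul_add, Matrix.trace_add, Matrix.trace_mul_single, Matrix.trace_mul_single,
        hDs.apply]
      simp [two_mul]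
    have := hDX E hEs
    linarith
  have hDcp : D ∈ cpCone k := by
    rw [cpCone_eq_psdCone_inter_nnCone hk]
    exact ⟨hDp, hDs, hDn⟩
  have := trace_mul_nonneg_of_mem_cpCone hDcp hM
  rw [hDX M hM.1] at this
  linarith

/-! ### Block diagonal matrices in the order cone of semidefinite matrices -/

theorem liftMatrix_add {k d : ℕ} (s : Fin k ↪o Fin d) (X Y : Matrix (Fin k) (Fin k) ℝ) :
    liftMatrix s (X + Y) = liftMatrix s X + liftMatrix s Y := by
  ext a b
  simp only [liftMatrix, Matrix.of_apply, Matrix.add_apply, ← Finset.sum_add_distrib]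
  refine Finset.sum_congr rfl fun p _ => Finset.sum_congr rfl fun q _ => ?_
  split_ifs <;> simp

theorem liftMatrix_smul {k d : ℕ} (s : Fin k ↪o Fin d) (t : ℝ) (X : Matrix (Fin k) (Fin k) ℝ) :
    liftMatrix s (t • X) = t • liftMatrix s X := by
  ext a b
  simp only [liftMatrix, Matrix.of_apply, Matrix.smul_apply, Finset.smul_sum]
  refine Finset.sum_congr rfl fun p _ => Finset.sum_congr rfl fun q _ => ?_
  split_ifs <;> simp

/-- The lift operator as a linear map. -/
def liftLinear {k d : ℕ} (s : Fin k ↪o Fin d) :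
    Matrix (Fin k) (Fin k) ℝ →ₗ[ℝ] Matrix (Fin d) (Fin d) ℝ where
  toFun := liftMatrix s
  map_add' := liftMatrix_add s
  map_smul' := liftMatrix_smul s

theorem liftLinear_apply {k d : ℕ} (s : Fin k ↪o Fin d) (X : Matrix (Fin k) (Fin k) ℝ) :
    liftLinear s X = liftMatrix s X := rfl

theorem liftMatrix_transpose {k d : ℕ} (s : Fin k ↪o Fin d) (X : Matrix (Fin k) (Fin k) ℝ) :
    (liftMatrix s X)ᵀ = liftMatrix s Xᵀ := by
  ext a b
  simp only [liftMatrix, Matrix.transpose_apply, Matrix.of_apply]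
  rw [Finset.sum_comm]
  simp only [and_comm]

theorem dotProduct_liftMatrix_mulVec {k d : ℕ} (s : Fin k ↪o Fin d)
    (X : Matrix (Fin k) (Fin k) ℝ) (x : Fin d → ℝ) :
    x ⬝ᵥ (liftMatrix s X *ᵥ x) = (x ∘ s) ⬝ᵥ (X *ᵥ (x ∘ s)) := by
  have h : ∀ a b, x a * (liftMatrix s X a b * x b) =
      ∑ p, ∑ q, if s p = a then if s q = b then x a * (X p q * x b) else 0 else 0 := fun a b => by
    simp only [liftMatrix, Matrix.of_apply, Finset.sum_mul, Finset.mul_sum]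
    refine Finset.sum_congr rfl fun p _ => Finset.sum_congr rfl fun q _ => ?_
    split_ifs <;> simp_all
  simp only [dotProduct, Matrix.mulVec, Finset.mul_sum, h, Function.comp_apply]
  calc _ = ∑ p, ∑ q, ∑ a, ∑ b,
        (if s p = a then if s q = b then x a * (X p q * x b) else 0 else 0) := by
        simp only [Finset.sum_comm (s := (Finset.univ : Finset (Fin d))) (t :=
          (Finset.univ : Finset (Fin k)))]
    _ = _ := by
        refine Finset.sum_congr rfl fun p _ => Finset.sum_congr rfl fun q _ => ?_
        simp

theorem posSemidef_liftMatrix {k d : ℕ} (s : Fin k ↪o Fin d) {X : Matrix (Fin k) (Fin k) ℝ}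
    (hX : X.PosSemidef) : (liftMatrix s X).PosSemidef := by
  obtain ⟨hs, hn⟩ := posSemidef_iff_isSymm_and_nonneg.1 hX
  refine posSemidef_iff_isSymm_and_nonneg.2 ⟨?_, fun x => ?_⟩
  · rw [Matrix.IsSymm, liftMatrix_transpose, hs.eq]
  · rw [dotProduct_liftMatrix_mulVec]
    exact hn _

theorem orderCone_psdCone_subset {k d : ℕ} (J : Finset (Fin k ↪o Fin d)) :
    orderCone psdCone J ⊆ psdCone d := by
  rintro _ ⟨N, hN, rfl⟩
  exact Matrix.posSemidef_sum J fun s hs => posSemidef_liftMatrix s (hN s hs)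

theorem sum_liftMatrix_mem_orderCone_univ {k d : ℕ} {ι : Type*} [Fintype ι]
    (e : ι → Fin k ↪o Fin d) {M : ι → Matrix (Fin k) (Fin k) ℝ} (hM : ∀ i, (M i).PosSemidef) :
    ∑ i, liftMatrix (e i) (M i) ∈
      orderCone psdCone (Finset.univ : Finset (Fin k ↪o Fin d)) := by
  classical
  refine ⟨fun s => ∑ i with e i = s, M i, fun s _ =>
    Matrix.posSemidef_sum _ fun i _ => hM i, ?_⟩
  simp only [← liftLinear_apply, map_sum]
  rw [← Finset.sum_fiberwise Finset.univ e]
  refine Finset.sum_congr rfl fun s _ => Finset.sum_congr rfl fun i hi => ?_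
  rw [(Finset.mem_filter.1 hi).2]

/-- The position of block `i` in a block diagonal matrix with blocks of size `k` indexed
by `ι`. -/
noncomputable def blockEmb (ι : Type*) [Fintype ι] (k : ℕ) (i : ι) :
    Fin k ↪o Fin (Fintype.card ι * k) :=
  OrderEmbedding.ofStrictMono (fun q => finProdFinEquiv (Fintype.equivFin ι i, q))
    fun p q h => by
      rw [Fin.lt_def] at h ⊢
      simpa [finProdFinEquiv] using h

theorem blockEmb_apply {ι : Type*} [Fintype ι] {k : ℕ} (i : ι) (q : Fin k) :
    blockEmb ι k i q = finProdFinEquiv (Fintype.equivFin ι i, q) := rfl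

/-- The block diagonal matrix with the given blocks of size `k`. -/
noncomputable def blockDiag {ι : Type*} [Fintype ι] {k : ℕ} (M : ι → Matrix (Fin k) (Fin k) ℝ) :
    Matrix (Fin (Fintype.card ι * k)) (Fin (Fintype.card ι * k)) ℝ :=
  ∑ i, liftMatrix (blockEmb ι k i) (M i)

theorem blockDiag_submatrix {ι : Type*} [Fintype ι] {k : ℕ} (M : ι → Matrix (Fin k) (Fin k) ℝ)
    (i : ι) : (blockDiag M).submatrix (blockEmb ι k i) (blockEmb ι k i) = M i := by
  ext p q
  rw [Matrix.submatrix_apply, blockDiag, Matrix.sum_apply, Finset.sum_eq_single i,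
    liftMatrix_apply_apply]
  · intro j _ hji
    refine liftMatrix_apply_of_notMem _ _ _ _ (Or.inl ?_)
    rintro ⟨r, hr⟩
    rw [blockEmb_apply, blockEmb_apply] at hr
    exact hji ((Fintype.equivFin ι).injective (Prod.ext_iff.1 (finProdFinEquiv.injective hr)).1)
  · simp

theorem posSemidef_submatrix_of_mem_orderCone {ι : Type*} [Fintype ι] {k : ℕ}
    {X : Matrix (Fin (Fintype.card ι * k)) (Fin (Fintype.card ι * k)) ℝ}
    (hX : X ∈ orderCone psdCone (Finset.univ : Finset (Fin k ↪o Fin (Fintype.card ι * k))))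
    (i : ι) : (X.submatrix (blockEmb ι k i) (blockEmb ι k i)).PosSemidef :=
  (orderCone_psdCone_subset _ hX).submatrix _

theorem blockDiag_mem_orderCone_iff {ι : Type*} [Fintype ι] {k : ℕ}
    (M : ι → Matrix (Fin k) (Fin k) ℝ) :
    blockDiag M ∈ orderCone psdCone (Finset.univ : Finset (Fin k ↪o Fin (Fintype.card ι * k))) ↔
      ∀ i, (M i).PosSemidef := by
  refine ⟨fun h i => ?_, fun h => sum_liftMatrix_mem_orderCone_univ _ h⟩
  rw [← blockDiag_submatrix M i]
  exact posSemidef_submatrix_of_mem_orderCone h i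

theorem isSymm_blockDiag {ι : Type*} [Fintype ι] {k : ℕ} {M : ι → Matrix (Fin k) (Fin k) ℝ}
    (hM : ∀ i, (M i).IsSymm) : (blockDiag M).IsSymm := by
  rw [Matrix.IsSymm, blockDiag, Matrix.transpose_sum]
  refine Finset.sum_congr rfl fun i _ => ?_
  rw [liftMatrix_transpose, (hM i).eq]

theorem le_card_mul (ι : Type*) [Fintype ι] [Nonempty ι] (k : ℕ) : k ≤ Fintype.card ι * k :=
  Nat.le_mul_of_pos_left k Fintype.card_pos

/-! ### Casting semidefinite block programs -/

theorem MinProblem.CastVia.trans {U V W : Type*} [AddCommGroup U] [Module ℝ U] [AddCommGroup V]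
    [Module ℝ V] [AddCommGroup W] [Module ℝ W] {π : V →ₗ[ℝ] U} {σ : W →ₗ[ℝ] V}
    {P : MinProblem U} {Q : MinProblem V} {R : MinProblem W}
    (hPQ : P.CastVia π Q) (hQR : Q.CastVia σ R) : P.CastVia (π ∘ₗ σ) R := by
  refine ⟨?_, fun w hw => ?_⟩
  · rw [LinearMap.coe_comp, Set.image_comp, hQR.1, hPQ.1]
  · rw [hQR.2 w hw, hPQ.2 _ (hQR.1 ▸ Set.mem_image_of_mem σ hw), LinearMap.comp_apply]

/-- The program of minimizing the linear functional `c` on a real vector space subject to linear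
equations `ℓ j y = b j` and to the semidefiniteness of `k × k` blocks `B i y` that depend linearly
on the variable. -/
def blockProgram {V ι ρ : Type*} [AddCommGroup V] [Module ℝ V] {k : ℕ}
    (B : ι → V →ₗ[ℝ] Matrix (Fin k) (Fin k) ℝ) (ℓ : ρ → V →ₗ[ℝ] ℝ) (b : ρ → ℝ) (c : V →ₗ[ℝ] ℝ) :
    MinProblem V where
  feasible := {y | (∀ i, (B i y).PosSemidef) ∧ ∀ j, ℓ j y = b j}
  objective := c

theorem posSemidef_smul_one_iff {k : ℕ} (hk : 1 ≤ k) (t : ℝ) :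
    (t • (1 : Matrix (Fin k) (Fin k) ℝ)).PosSemidef ↔ 0 ≤ t := by
  refine ⟨fun h => ?_, fun h => Matrix.PosSemidef.one.smul h⟩
  simpa using h.diag_nonneg (i := ⟨0, hk⟩)

/-- In coordinates, finitely many semidefiniteness constraints on affine `k × k` blocks are the
single constraint that their block diagonal matrix lies in the order cone. -/
theorem exists_inequalityForm_of_affine_blocks {V ι : Type*} [AddCommGroup V] [Module ℝ V]
    [Fintype ι] {k n : ℕ} (φ : (Fin n → ℝ) ≃ₗ[ℝ] V) (B : ι → V →ₗ[ℝ] Matrix (Fin k) (Fin k) ℝ)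
    (hB : ∀ i y, (B i y).IsSymm) (D : ι → Matrix (Fin k) (Fin k) ℝ) (hD : ∀ i, (D i).IsSymm)
    (c : V →ₗ[ℝ] ℝ) :
    ∃ Q : InequalityForm (Fintype.card ι * k) n,
      MinProblem.CastVia φ.toLinearMap ⟨{y | ∀ i, (B i y + D i).PosSemidef}, c⟩
        (Q.over (orderCone psdCone
          (Finset.univ : Finset (Fin k ↪o Fin (Fintype.card ι * k))))) := by
  have hsum : ∀ (x : Fin n → ℝ), x = ∑ j, x j • Pi.single j 1 := fun x => by
    ext l
    simp [Pi.single_apply]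
  refine ⟨⟨fun j => c (φ (Pi.single j 1)), blockDiag D,
    fun j => blockDiag fun i => B i (φ (Pi.single j 1)), isSymm_blockDiag hD,
    fun j => isSymm_blockDiag fun i => hB i _⟩, ?_, fun x _ => ?_⟩
  · have hfeas : ∀ x : Fin n → ℝ, (∑ j, x j • blockDiag (fun i => B i (φ (Pi.single j 1))) +
        blockDiag D ∈ orderCone psdCone (Finset.univ : Finset (Fin k ↪o _))) ↔
        ∀ i, (B i (φ x) + D i).PosSemidef := fun x => by
      rw [← blockDiag_mem_orderCone_iff]
      have : ∑ j, x j • blockDiag (fun i => B i (φ (Pi.single j 1))) + blockDiag D =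
          blockDiag fun i => B i (φ x) + D i := by
        simp only [blockDiag, liftMatrix_add, Finset.sum_add_distrib, Finset.smul_sum]
        rw [Finset.sum_comm]
        congr 1
        refine Finset.sum_congr rfl fun i _ => ?_
        conv_rhs => rw [hsum x]
        simp only [← liftLinear_apply, map_sum, map_smul]
      rw [this]
    ext y
    constructor
    · rintro ⟨x, hx, rfl⟩
      exact (hfeas x).1 hx
    · intro hy
      refine ⟨φ.symm y, (hfeas _).2 ?_, φ.apply_symm_apply y⟩
      rw [φ.apply_symm_apply]
      exact hy
  · change _ = c (φ x)
    conv_rhs => rw [hsum x]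
    simp [InequalityForm.over, dotProduct, mul_comm]

/-- Block programs with fixed blocks, and with arbitrary linear equations and objective, are cast
uniformly into inequality form. An equation becomes two opposite inequalities, each of them the
semidefiniteness of a multiple of the identity block. -/
theorem exists_inequalityForm_of_blockProgram {V ι ρ : Type*} [AddCommGroup V] [Module ℝ V]
    [FiniteDimensional ℝ V] [Fintype ι] [Fintype ρ] {k : ℕ} (hk : 1 ≤ k)
    (B : ι → V →ₗ[ℝ] Matrix (Fin k) (Fin k) ℝ) (hB : ∀ i y, (B i y).IsSymm) :
    ∃ d' n' : ℕ, k ≤ d' ∧ ∃ π : (Fin n' → ℝ) →ₗ[ℝ] V,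
      ∀ (ℓ : ρ → V →ₗ[ℝ] ℝ) (b : ρ → ℝ) (c : V →ₗ[ℝ] ℝ), ∃ Q : InequalityForm d' n',
        (blockProgram B ℓ b c).CastVia π
          (Q.over (orderCone psdCone (Finset.univ : Finset (Fin k ↪o Fin d')))) := by
  set φ := (Module.finBasis ℝ V).equivFun.symm
  -- the additional index `none` makes sure that there is a block at all
  refine ⟨Fintype.card (Option (ι ⊕ ρ ⊕ ρ)) * k, _, le_card_mul _ k, φ.toLinearMap,
    fun ℓ b c => ?_⟩
  obtain ⟨Q, hQ⟩ := exists_inequalityForm_of_affine_blocks φ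
    (fun i : Option (ι ⊕ ρ ⊕ ρ) => i.elim 0
      (Sum.elim B (Sum.elim (fun j => (ℓ j).smulRight 1) fun j => (-ℓ j).smulRight 1)))
    (by
      rintro (_ | i | j | j) y
      · exact Matrix.isSymm_zero
      · exact hB i y
      · exact Matrix.isSymm_one.smul _
      · exact Matrix.isSymm_one.smul _)
    (fun i => i.elim 0 (Sum.elim 0 (Sum.elim (fun j => (-b j) • 1) fun j => b j • 1)))
    (by
      rintro (_ | i | j | j)
      · exact Matrix.isSymm_zero
      · exact Matrix.isSymm_zero
      · exact Matrix.isSymm_one.smul _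
      · exact Matrix.isSymm_one.smul _) c
  refine ⟨Q, ?_⟩
  convert hQ using 1
  rw [blockProgram]
  congr 1
  ext y
  simp only [Option.forall, Sum.forall, Option.elim_none, Option.elim_some, Sum.elim_inl,
    Sum.elim_inr, LinearMap.smulRight_apply, ← add_smul, posSemidef_smul_one_iff hk,
    Pi.zero_apply, add_zero, LinearMap.zero_apply, Matrix.PosSemidef.zero, true_and,
    LinearMap.neg_apply, Set.mem_ofPred_eq, ← forall_and]
  refine and_congr_right fun _ => forall_congr' fun j => ?_
  constructor
  · intro h
    constructor <;> linarith
  · rintro ⟨h1, h2⟩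
    linarith

theorem exists_standardForm_feasible_eq {d : ℕ} {ρ : Type*} [Fintype ρ]
    (f : ρ → Matrix (Fin d) (Fin d) ℝ →ₗ[ℝ] ℝ) (b : ρ → ℝ)
    (c : Matrix (Fin d) (Fin d) ℝ →ₗ[ℝ] ℝ) (K : Set (Matrix (Fin d) (Fin d) ℝ)) :
    ∃ Q : StandardForm d (Fintype.card ρ), Q.over K = ⟨{X | (∀ j, f j X = b j) ∧ X ∈ K}, c⟩ := by
  choose A hA using fun j => exists_eq_trace_mul (f j)
  obtain ⟨A₀, hA₀⟩ := exists_eq_trace_mul c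
  set e := Fintype.equivFin ρ
  refine ⟨⟨A₀, fun i => A (e.symm i), fun i => b (e.symm i)⟩, ?_⟩
  rw [StandardForm.over]
  congr 1
  · ext X
    simp only [← hA, Set.mem_ofPred_eq]
    exact and_congr_left fun _ => e.symm.forall_congr_left.trans (by simp)
  · ext X
    exact (hA₀ X).symm

/-- Block programs with fixed blocks, and with arbitrary linear equations and objective, are cast
uniformly into standard form. The semidefinite variable has one diagonal block for each `B i`, and
one more for each coordinate of the free variable, which is read off as the difference of the first
two diagonal entries of that block. -/
theorem exists_standardForm_of_blockProgram {V ι ρ : Type*} [AddCommGroup V] [Module ℝ V]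
    [FiniteDimensional ℝ V] [Fintype ι] [Fintype ρ] {k : ℕ} (hk : 2 ≤ k)
    (B : ι → V →ₗ[ℝ] Matrix (Fin k) (Fin k) ℝ) :
    ∃ d' p' : ℕ, k ≤ d' ∧ ∃ π : Matrix (Fin d') (Fin d') ℝ →ₗ[ℝ] V,
      ∀ (ℓ : ρ → V →ₗ[ℝ] ℝ) (b : ρ → ℝ) (c : V →ₗ[ℝ] ℝ), ∃ Q : StandardForm d' p',
        (blockProgram B ℓ b c).CastVia π
          (Q.over (orderCone psdCone (Finset.univ : Finset (Fin k ↪o Fin d')))) := by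
  set n := Module.finrank ℝ V
  set φ := (Module.finBasis ℝ V).equivFun.symm
  -- the additional index `none` makes sure that there is a block at all
  let κ := Option (ι ⊕ Fin n)
  let z : Fin k := ⟨0, by omega⟩
  let o : Fin k := ⟨1, by omega⟩
  have hzo : o ≠ z := by simp [o, z, Fin.ext_iff]
  let entry : κ → Fin k → Fin k →
      Matrix (Fin (Fintype.card κ * k)) (Fin (Fintype.card κ * k)) ℝ →ₗ[ℝ] ℝ :=
    fun i p q => Matrix.entryLinearMap ℝ ℝ (blockEmb κ k i p) (blockEmb κ k i q)
  have hentry : ∀ i p q X, entry i p q X =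
      X.submatrix (blockEmb κ k i) (blockEmb κ k i) p q := fun _ _ _ _ => rfl
  let π : Matrix (Fin (Fintype.card κ * k)) (Fin (Fintype.card κ * k)) ℝ →ₗ[ℝ] V :=
    φ.toLinearMap ∘ₗ LinearMap.pi fun j =>
      entry (some (Sum.inr j)) z z - entry (some (Sum.inr j)) o o
  refine ⟨Fintype.card κ * k, Fintype.card ((ι × Fin k × Fin k) ⊕ ρ), le_card_mul κ k, π,
    fun ℓ b c => ?_⟩
  obtain ⟨Q, hQ⟩ := exists_standardForm_feasible_eq
    (Sum.elim (fun x : ι × Fin k × Fin k => entry (some (Sum.inl x.1)) x.2.1 x.2.2 -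
      Matrix.entryLinearMap ℝ ℝ x.2.1 x.2.2 ∘ₗ B x.1 ∘ₗ π) fun j => ℓ j ∘ₗ π)
    (Sum.elim 0 b) (c ∘ₗ π) (orderCone psdCone (Finset.univ : Finset (Fin k ↪o _)))
  refine ⟨Q, ?_⟩
  rw [hQ]
  refine ⟨?_, fun X _ => rfl⟩
  ext y
  constructor
  · rintro ⟨X, ⟨hX, hXK⟩, rfl⟩
    refine ⟨fun i => ?_, fun j => hX (Sum.inr j)⟩
    have : B i (π X) = X.submatrix (blockEmb κ k (some (Sum.inl i)))
        (blockEmb κ k (some (Sum.inl i))) := by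
      ext p q
      exact (sub_eq_zero.1 (hX (Sum.inl (i, p, q)))).symm
    rw [this]
    exact posSemidef_submatrix_of_mem_orderCone hXK _
  · rintro ⟨hy, hℓ⟩
    set x := φ.symm y with hx
    let M : κ → Matrix (Fin k) (Fin k) ℝ := fun i => i.elim 0
      (Sum.elim (fun i => B i y) fun j =>
        Matrix.diagonal fun p => if p = z then max (x j) 0 else max (-x j) 0)
    have hπ : π (blockDiag M) = y := by
      rw [← φ.apply_symm_apply y]
      refine congrArg φ ?_
      ext j
      simp only [LinearMap.pi_apply, LinearMap.sub_apply, hentry, blockDiag_submatrix]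
      simp only [M, Option.elim_some, Sum.elim_inr, Matrix.diagonal_apply_eq, if_neg hzo, if_true,
        max_zero_sub_max_neg_zero_eq_self]
      rfl
    refine ⟨blockDiag M, ⟨?_, (blockDiag_mem_orderCone_iff M).2 ?_⟩, hπ⟩
    · rintro (⟨i, p, q⟩ | j)
      · simp only [Sum.elim_inl, LinearMap.sub_apply, LinearMap.comp_apply, hπ, hentry,
          blockDiag_submatrix]
        exact sub_self _
      · simp only [Sum.elim_inr, LinearMap.comp_apply, hπ]
        exact hℓ j
    · rintro (_ | i | j)
      · exact Matrix.PosSemidef.zero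
      · exact hy i
      · refine Matrix.posSemidef_diagonal_iff.2 fun p => ?_
        split_ifs <;> exact le_max_right _ _

/-! ### Order cones as images of semidefinite block cones -/

/-- A set is a shadow of `k × k` semidefinite blocks if it is the linear image of the set of points
of a finite-dimensional space at which finitely many linear maps into the symmetric `k × k` matrices
take positive semidefinite values. -/
def IsBlockShadow (k : ℕ) {E : Type*} [AddCommGroup E] [Module ℝ E] (K : Set E) : Prop :=
  ∃ (V : Type) (_ : AddCommGroup V) (_ : Module ℝ V) (_ : FiniteDimensional ℝ V) (ι : Type)
    (_ : Fintype ι) (B : ι → V →ₗ[ℝ] Matrix (Fin k) (Fin k) ℝ) (Λ : V →ₗ[ℝ] E),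
    (∀ i y, (B i y).IsSymm) ∧ K = Λ '' {y | ∀ i, (B i y).PosSemidef}

theorem IsBlockShadow.orderCone {C : ∀ m : ℕ, Set (Matrix (Fin m) (Fin m) ℝ)} {k d : ℕ}
    (hC : IsBlockShadow k (C k)) (J : Finset (Fin k ↪o Fin d)) :
    IsBlockShadow k (orderCone C J) := by
  obtain ⟨V, _, _, _, ι, _, B, Λ, hB, hCk⟩ := hC
  refine ⟨(Fin k ↪o Fin d) → V, inferInstance, inferInstance, inferInstance, J × ι, inferInstance,
    fun x => B x.2 ∘ₗ LinearMap.proj x.1.1,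
    ∑ s ∈ J, liftLinear s ∘ₗ Λ ∘ₗ LinearMap.proj s, fun x y => hB _ _, ?_⟩
  ext M
  constructor
  · rintro ⟨N, hN, rfl⟩
    have h : ∀ s, ∃ y : V, s ∈ J → (∀ i, (B i y).PosSemidef) ∧ Λ y = N s := fun s => by
      by_cases hs : s ∈ J
      · obtain ⟨y, hy, hyN⟩ := hCk ▸ hN s hs
        exact ⟨y, fun _ => ⟨hy, hyN⟩⟩
      · exact ⟨0, fun h => absurd h hs⟩
    choose y hy using h
    refine ⟨y, fun x => (hy x.1.1 x.1.2).1 x.2, ?_⟩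
    rw [LinearMap.sum_apply]
    exact Finset.sum_congr rfl fun s hs => congrArg (liftMatrix s) (hy s hs).2
  · rintro ⟨y, hy, rfl⟩
    refine ⟨fun s => Λ (y s), fun s hs => ?_, ?_⟩
    · rw [hCk]
      exact ⟨y s, fun i => hy (⟨s, hs⟩, i), rfl⟩
    · rw [LinearMap.sum_apply]
      rfl

/-- Symmetrization, which parametrizes the symmetric matrices by all matrices. -/
def symmetrize (k : ℕ) : Matrix (Fin k) (Fin k) ℝ →ₗ[ℝ] Matrix (Fin k) (Fin k) ℝ :=
  LinearMap.id + (Matrix.transposeLinearEquiv (Fin k) (Fin k) ℝ ℝ).toLinearMap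

theorem symmetrize_apply {k : ℕ} (X : Matrix (Fin k) (Fin k) ℝ) : symmetrize k X = X + Xᵀ := rfl

theorem isSymm_symmetrize {k : ℕ} (X : Matrix (Fin k) (Fin k) ℝ) : (symmetrize k X).IsSymm := by
  rw [symmetrize_apply, Matrix.IsSymm, Matrix.transpose_add, Matrix.transpose_transpose, add_comm]

theorem symmetrize_half {k : ℕ} {X : Matrix (Fin k) (Fin k) ℝ} (hX : X.IsSymm) :
    symmetrize k ((1 / 2 : ℝ) • X) = X := by
  rw [map_smul, symmetrize_apply, hX.eq, ← two_smul ℝ X, smul_smul]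
  norm_num

theorem isBlockShadow_cpCone {k : ℕ} (hk1 : 1 ≤ k) (hk : k ≤ 4) : IsBlockShadow k (cpCone k) := by
  refine ⟨Matrix (Fin k) (Fin k) ℝ, inferInstance, inferInstance, inferInstance,
    Option (Fin k × Fin k), inferInstance,
    fun i => i.elim (symmetrize k)
      fun x => (Matrix.entryLinearMap ℝ ℝ x.1 x.2 ∘ₗ symmetrize k).smulRight 1,
    symmetrize k, ?_, ?_⟩
  · rintro (_ | x) y
    · exact isSymm_symmetrize y
    · exact Matrix.isSymm_one.smul _
  · rw [cpCone_eq_psdCone_inter_nnCone hk]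
    simp only [Option.forall, Option.elim_none, Option.elim_some, LinearMap.smulRight_apply,
      posSemidef_smul_one_iff hk1, LinearMap.comp_apply, Prod.forall]
    ext X
    constructor
    · rintro ⟨hp, hs, hn⟩
      refine ⟨(1 / 2 : ℝ) • X, ⟨?_, fun p q => ?_⟩, symmetrize_half hs⟩
      · rw [symmetrize_half hs]
        exact hp
      · rw [symmetrize_half hs]
        exact hn p q
    · rintro ⟨Y, ⟨hp, hn⟩, rfl⟩
      exact ⟨hp, isSymm_symmetrize Y, hn⟩

theorem isBlockShadow_copCone {k : ℕ} (hk1 : 1 ≤ k) (hk : k ≤ 4) :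
    IsBlockShadow k (copCone k) := by
  refine ⟨Matrix (Fin k) (Fin k) ℝ × Matrix (Fin k) (Fin k) ℝ, inferInstance, inferInstance,
    inferInstance, Option (Fin k × Fin k), inferInstance,
    fun i => i.elim (symmetrize k ∘ₗ LinearMap.fst ℝ _ _) fun x =>
      (Matrix.entryLinearMap ℝ ℝ x.1 x.2 ∘ₗ symmetrize k ∘ₗ LinearMap.snd ℝ _ _).smulRight 1,
    (symmetrize k).coprod (symmetrize k), ?_, ?_⟩
  · rintro (_ | x) y
    · exact isSymm_symmetrize _
    · exact Matrix.isSymm_one.smul _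
  · rw [copCone_eq_psdCone_add_nnCone hk]
    simp only [Option.forall, Option.elim_none, Option.elim_some, LinearMap.smulRight_apply,
      posSemidef_smul_one_iff hk1, LinearMap.comp_apply, Prod.forall]
    ext X
    constructor
    · rintro ⟨Y, hY, Z, hZ, rfl⟩
      have hYs : symmetrize k ((1 / 2 : ℝ) • Y) = Y := symmetrize_half hY.isSymm_real
      have hZs : symmetrize k ((1 / 2 : ℝ) • Z) = Z := symmetrize_half hZ.1
      refine ⟨((1 / 2 : ℝ) • Y, (1 / 2 : ℝ) • Z), ⟨?_, fun p q => ?_⟩, ?_⟩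
      · rw [LinearMap.fst_apply, hYs]
        exact hY
      · rw [LinearMap.snd_apply, hZs]
        exact hZ.2 p q
      · simp only [LinearMap.coprod_apply, hYs, hZs]
    · rintro ⟨⟨Y, Z⟩, ⟨hp, hn⟩, rfl⟩
      exact ⟨_, hp, _, ⟨isSymm_symmetrize Z, hn⟩, rfl⟩

/-! ### Casting programs over block shadows into block programs -/

theorem exists_blockProgram_of_standardForm {V ι : Type*} [AddCommGroup V] [Module ℝ V] {k d p : ℕ}
    (B : ι → V →ₗ[ℝ] Matrix (Fin k) (Fin k) ℝ) (Λ : V →ₗ[ℝ] Matrix (Fin d) (Fin d) ℝ)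
    (P : StandardForm d p) :
    ∃ (ℓ : Fin p → V →ₗ[ℝ] ℝ) (b : Fin p → ℝ) (c : V →ₗ[ℝ] ℝ),
      (P.over (Λ '' {y | ∀ i, (B i y).PosSemidef})).CastVia Λ (blockProgram B ℓ b c) := by
  let T : Matrix (Fin d) (Fin d) ℝ → V →ₗ[ℝ] ℝ := fun A =>
    Matrix.traceLinearMap (Fin d) ℝ ℝ ∘ₗ LinearMap.mulLeft ℝ A ∘ₗ Λ
  refine ⟨fun i => T (P.A i), P.b, T P.A₀, ?_, fun _ _ => rfl⟩
  ext X
  constructor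
  · rintro ⟨y, ⟨hy, hℓ⟩, rfl⟩
    exact ⟨hℓ, y, hy, rfl⟩
  · rintro ⟨hA, y, hy, rfl⟩
    exact ⟨y, ⟨hy, hA⟩, rfl⟩

/-- The block program has as variables those of the given program and a preimage under `Λ` of the
matrix that is to lie in the cone; an equation for each entry links the two. -/
theorem exists_blockProgram_of_inequalityForm {V ι : Type*} [AddCommGroup V] [Module ℝ V]
    {k d n : ℕ} (B : ι → V →ₗ[ℝ] Matrix (Fin k) (Fin k) ℝ)
    (Λ : V →ₗ[ℝ] Matrix (Fin d) (Fin d) ℝ) (P : InequalityForm d n) :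
    ∃ (ℓ : Fin d × Fin d → (Fin n → ℝ) × V →ₗ[ℝ] ℝ) (b : Fin d × Fin d → ℝ)
      (c : (Fin n → ℝ) × V →ₗ[ℝ] ℝ),
      (P.over (Λ '' {y | ∀ i, (B i y).PosSemidef})).CastVia (LinearMap.fst ℝ (Fin n → ℝ) V)
        (blockProgram (fun i => B i ∘ₗ LinearMap.snd ℝ (Fin n → ℝ) V) ℓ b c) := by
  let F : (Fin n → ℝ) × V →ₗ[ℝ] Matrix (Fin d) (Fin d) ℝ :=
    Λ ∘ₗ LinearMap.snd ℝ _ _ - Fintype.linearCombination ℝ P.P ∘ₗ LinearMap.fst ℝ _ _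
  refine ⟨fun x => Matrix.entryLinearMap ℝ ℝ x.1 x.2 ∘ₗ F, fun x => P.P₀ x.1 x.2,
    dotProductBilin ℝ ℝ P.q ∘ₗ LinearMap.fst ℝ _ _, ?_, fun _ _ => rfl⟩
  have hF : ∀ x y, (∀ u : Fin d × Fin d, F (x, y) u.1 u.2 = P.P₀ u.1 u.2) ↔
      Λ y = ∑ i, x i • P.P i + P.P₀ := fun x y => by
    rw [← sub_eq_iff_eq_add', ← Matrix.ext_iff, Prod.forall]
    rfl
  ext x
  constructor
  · rintro ⟨⟨x, y⟩, ⟨hy, hℓ⟩, rfl⟩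
    exact ⟨y, hy, (hF x y).1 hℓ⟩
  · rintro ⟨y, hy, h⟩
    exact ⟨(x, y), ⟨hy, (hF x y).2 h⟩, rfl⟩

theorem mainTheorem10 :
    (∀ k : ℕ, 1 ≤ k → k ≤ 4 →
      copCone k = psdCone k + nnCone k ∧ cpCone k = psdCone k ∩ nnCone k) ∧
    (∀ k : ℕ, 2 ≤ k → k ≤ 4 →
      ∀ C : (∀ m : ℕ, Set (Matrix (Fin m) (Fin m) ℝ)), (C = copCone ∨ C = cpCone) →
      ∀ d : ℕ, k ≤ d → ∀ J : Finset (Fin k ↪o Fin d),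
        -- standard form into standard form and into inequality form
        (∀ p : ℕ,
          (∃ d' p' : ℕ, k ≤ d' ∧
            ∃ π : Matrix (Fin d') (Fin d') ℝ →ₗ[ℝ] Matrix (Fin d) (Fin d) ℝ,
              ∀ P : StandardForm d p, ∃ Q : StandardForm d' p',
                MinProblem.CastVia π (P.over (orderCone C J))
                  (Q.over (orderCone psdCone (Finset.univ : Finset (Fin k ↪o Fin d'))))) ∧
          (∃ d' n' : ℕ, k ≤ d' ∧
            ∃ π : (Fin n' → ℝ) →ₗ[ℝ] Matrix (Fin d) (Fin d) ℝ,
              ∀ P : StandardForm d p, ∃ Q : InequalityForm d' n',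
                MinProblem.CastVia π (P.over (orderCone C J))
                  (Q.over (orderCone psdCone (Finset.univ : Finset (Fin k ↪o Fin d')))))) ∧
        -- inequality form into standard form and into inequality form
        (∀ n : ℕ,
          (∃ d' p' : ℕ, k ≤ d' ∧
            ∃ π : Matrix (Fin d') (Fin d') ℝ →ₗ[ℝ] (Fin n → ℝ),
              ∀ P : InequalityForm d n, ∃ Q : StandardForm d' p',
                MinProblem.CastVia π (P.over (orderCone C J))
                  (Q.over (orderCone psdCone (Finset.univ : Finset (Fin k ↪o Fin d'))))) ∧
          (∃ d' n' : ℕ, k ≤ d' ∧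
            ∃ π : (Fin n' → ℝ) →ₗ[ℝ] (Fin n → ℝ),
              ∀ P : InequalityForm d n, ∃ Q : InequalityForm d' n',
                MinProblem.CastVia π (P.over (orderCone C J))
                  (Q.over (orderCone psdCone (Finset.univ : Finset (Fin k ↪o Fin d'))))))) := by
  refine ⟨fun k _ hk4 => ⟨copCone_eq_psdCone_add_nnCone hk4, cpCone_eq_psdCone_inter_nnCone hk4⟩,
    fun k hk2 hk4 C hC d _ J => ?_⟩
  have hCk : IsBlockShadow k (C k) := by
    rcases hC with rfl | rfl
    · exact isBlockShadow_copCone (by omega) hk4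
    · exact isBlockShadow_cpCone (by omega) hk4
  obtain ⟨V, _, _, _, ι, _, B, Λ, hB, hK⟩ := hCk.orderCone J
  rw [hK]
  refine ⟨fun p => ⟨?_, ?_⟩, fun n => ⟨?_, ?_⟩⟩
  · obtain ⟨d', p', hd', π, hπ⟩ := exists_standardForm_of_blockProgram (ρ := Fin p) hk2 B
    refine ⟨d', p', hd', Λ ∘ₗ π, fun P => ?_⟩
    obtain ⟨ℓ, b, c, hP⟩ := exists_blockProgram_of_standardForm B Λ P
    exact (hπ ℓ b c).imp fun Q hQ => hP.trans hQ
  · obtain ⟨d', n', hd', π, hπ⟩ :=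
      exists_inequalityForm_of_blockProgram (ρ := Fin p) (by omega) B hB
    refine ⟨d', n', hd', Λ ∘ₗ π, fun P => ?_⟩
    obtain ⟨ℓ, b, c, hP⟩ := exists_blockProgram_of_standardForm B Λ P
    exact (hπ ℓ b c).imp fun Q hQ => hP.trans hQ
  · obtain ⟨d', p', hd', π, hπ⟩ := exists_standardForm_of_blockProgram
      (ρ := Fin d × Fin d) hk2 fun i => B i ∘ₗ LinearMap.snd ℝ (Fin n → ℝ) V
    refine ⟨d', p', hd', LinearMap.fst ℝ (Fin n → ℝ) V ∘ₗ π, fun P => ?_⟩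
    obtain ⟨ℓ, b, c, hP⟩ := exists_blockProgram_of_inequalityForm B Λ P
    exact (hπ ℓ b c).imp fun Q hQ => hP.trans hQ
  · obtain ⟨d', n', hd', π, hπ⟩ := exists_inequalityForm_of_blockProgram
      (ρ := Fin d × Fin d) (by omega) (fun i => B i ∘ₗ LinearMap.snd ℝ (Fin n → ℝ) V)
      fun i y => hB i y.2
    refine ⟨d', n', hd', LinearMap.fst ℝ (Fin n → ℝ) V ∘ₗ π, fun P => ?_⟩
    obtain ⟨ℓ, b, c, hP⟩ := exists_blockProgram_of_inequalityForm B Λ P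
    exact (hπ ℓ b c).imp fun Q hQ => hP.trans hQ
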